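/- Let $\mathbb S^2=\{x\in\mathbb R^3:\|x\|=1\}$ with surface measure $\lambda$, let $a\in(0,1)$, $\theta\in\mathbb R$, $u\in\mathbb S^2$, $\kappa\ge 0$, let $R_{\theta,u}$ be the rotation of angle $\theta$ around the axis directed by $u$, and let $f(x;\mu,\kappa)=\frac{\kappa}{4\pi\sinh\kappa}\exp(\kappa\,\mu'x)$, $x,\mu\in\mathbb S^2$, be the von Mises–Fisher density (equal to $1/(4\pi)$ if $\kappa=0$). Let $\mathcal C=\mathcal C(\mathbb S^2,(0,\infty))$ be the space of continuous positive functions on $\mathbb S^2$, with the uniform distance and its Borel $\sigma$-algebra. Let $(X(t,\cdot))_{t\in\mathbb Z}$ and $(Z(t,\cdot))_{t\in\mathbb Z}$ be $\mathcal C$-valued random processes such that, for every $t\in\mathbb Z$, almost surely $$X(t,x)=\max\big(aX(t-1,R_{\theta,u}x),\,(1-a)Z(t,x)\big),\qquad x\in\mathbb S^2,$$ where $Z(t,\cdot)$ is independent of $(X(s,\cdot))_{s<t}$ and has the same finite-dimensional distributions as $x\mapsto\bigvee_{i\ge1}U_if(x;\mu_i,\kappa)$, with $(U_i,\mu_i)_{i\ge1}$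 the points of a Poisson point process on $(0,\infty)\times\mathbb S^2$ of intensity $r^{-2}\,dr\times\lambda(d\mu)$. For $h\in\mathcal C$ let $\mathcal P(h,\cdot)$ be the law of $x\mapsto\max(ah(R_{\theta,u}x),(1-a)Z(0,x))$, and write $\mathcal P^n\varphi(h)=\int\varphi\,d\mathcal P^n(h,\cdot)$ and $\pi(\varphi)=\int\varphi\,d\pi$. Then $(X(t,\cdot))_{t\in\mathbb Z}$ is a Markov chain with transition kernel $\mathcal P$, and there is a unique probability measure $\pi$ on $\mathcal C$ that is invariant for $\mathcal P$. Moreover, for every $\gamma\in(0,1)$, setting $L(h)=\sup_{x\in\mathbb S^2}h(x)^\gamma$ and $\|\varphi\|_L=\sup_{h\in\mathcal C}\frac{|\varphi(h)|}{1+L(h)}$, there are constants $C>0$ and $\rho\in(0,1)$ such that, for every measurable $\varphi:\mathcal C\to\mathbb R$ with $\|\varphi\|_L<\infty$ and every integer $n\ge0$, the integrals $\pi(\varphi)$ and $\mathcal P^n\varphi(h)$, $h\in\mathcal C$, converge absolutely and $$\|\mathcal P^n\varphi-\pi(\varphi)\|_L\le C\rho^n\,\|\varphi-\pi(\varphi)\|_L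 .$$ -/

import Mathlib

open MeasureTheory ProbabilityTheory
open scoped ENNReal

noncomputable section

/-- The unit sphere of the Euclidean space `ℝ³`. -/
abbrev S2 : Type := Metric.sphere (0 : EuclideanSpace ℝ (Fin 3)) 1

/-- The surface (Lebesgue) measure of the unit sphere, of total mass `4π`. -/
def sphereMeasure : Measure S2 :=
  (volume : Measure (EuclideanSpace ℝ (Fin 3))).toSphere

/-- The von Mises--Fisher density at `x` with mean direction `m` and concentration `κ`
(the uniform density if `κ = 0`). -/
def vonMisesFisher (κ : ℝ) (m x : S2) : ℝ :=
  (if κ = 0 then 1 / (4 * Real.pi) else κ / (4 * Real.pi * Real.sinh κ)) *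
    Real.exp (κ * inner ℝ (m : EuclideanSpace ℝ (Fin 3)) (x : EuclideanSpace ℝ (Fin 3)))

/-- The cross product matrix of `u`. -/
def crossMatrix (u : Fin 3 → ℝ) : Matrix (Fin 3) (Fin 3) ℝ :=
  !![0, -u 2, u 1; u 2, 0, -u 0; -u 1, u 0, 0]

/-- The matrix of the rotation of angle `θ` around the axis directed by `u`. -/
def rotationMatrix (θ : ℝ) (u : Fin 3 → ℝ) : Matrix (Fin 3) (Fin 3) ℝ :=
  Real.cos θ • (1 : Matrix (Fin 3) (Fin 3) ℝ) + Real.sin θ • crossMatrix u +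
    (1 - Real.cos θ) • Matrix.vecMulVec u u

theorem norm_rotationMatrix_mulVec (θ : ℝ) (u x : S2) :
    ‖WithLp.toLp 2 (Matrix.mulVec (rotationMatrix θ u.1.ofLp) x.1.ofLp)‖ = 1 := by
  have hu : ‖u.1‖ ^ 2 = 1 := by rw [norm_eq_of_mem_sphere u]; norm_num
  have hx : ‖x.1‖ ^ 2 = 1 := by rw [norm_eq_of_mem_sphere x]; norm_num
  have hθ := Real.sin_sq_add_cos_sq θ
  rw [EuclideanSpace.norm_sq_eq, Fin.sum_univ_three] at hu hx
  simp only [Real.norm_eq_abs, sq_abs] at hu hx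
  rw [← sq_eq_sq₀ (norm_nonneg _) zero_le_one, EuclideanSpace.norm_sq_eq, Fin.sum_univ_three]
  simp only [Real.norm_eq_abs, sq_abs, rotationMatrix, crossMatrix, Matrix.mulVec, dotProduct,
    Fin.sum_univ_three, Matrix.add_apply, Matrix.smul_apply, Matrix.vecMulVec_apply,
    Matrix.one_apply, smul_eq_mul]
  simp
  generalize u.1.ofLp 0 = a at *
  generalize u.1.ofLp 1 = b at *
  generalize u.1.ofLp 2 = c at *
  generalize x.1.ofLp 0 = p at *
  generalize x.1.ofLp 1 = q at *
  generalize x.1.ofLp 2 = r at *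
  generalize Real.cos θ = k at *
  generalize Real.sin θ = s at *
  linear_combination
    (s ^ 2 * (p ^ 2 + q ^ 2 + r ^ 2) + (1 - k) ^ 2 * (a * p + b * q + c * r) ^ 2) * hu +
      (p ^ 2 + q ^ 2 + r ^ 2 - (a * p + b * q + c * r) ^ 2) * hθ + hx

/-- The rotation `R_{θ,u}` of the sphere. -/
def sphereRotation (θ : ℝ) (u : S2) : C(S2, S2) where
  toFun x := ⟨WithLp.toLp 2 (Matrix.mulVec (rotationMatrix θ u.1.ofLp) x.1.ofLp), by
    simpa using norm_rotationMatrix_mulVec θ u x⟩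
  continuous_toFun := by
    refine Continuous.subtype_mk ?_ _
    refine (PiLp.continuous_toLp 2 _).comp ?_
    refine Continuous.matrix_mulVec continuous_const ?_
    exact (PiLp.continuous_ofLp 2 _).comp continuous_subtype_val

/-- The state space: continuous functions from the sphere to `(0, ∞)`, with Mathlib's uniform
distance `d(h₁, h₂) = sup |h₁ - h₂|`. -/
abbrev PosField : Type := C(S2, Set.Ioi (0 : ℝ))

instance : MeasurableSpace PosField := borel PosField

instance : BorelSpace PosField := ⟨rfl⟩

/-- One step of the recurrence: the function `x ↦ max (a h(R_{θ,u} x)) ((1 - a) z(x))`. -/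
def step (a : Set.Ioo (0 : ℝ) 1) (θ : ℝ) (u : S2) (h z : PosField) : PosField where
  toFun x := ⟨max (a * (h (sphereRotation θ u x) : ℝ)) ((1 - a) * (z x : ℝ)),
    lt_max_of_lt_left (mul_pos a.2.1 (h (sphereRotation θ u x)).2)⟩
  continuous_toFun := by
    refine Continuous.subtype_mk ?_ _
    fun_prop

theorem continuous_step (a : Set.Ioo (0 : ℝ) 1) (θ : ℝ) (u : S2) :
    Continuous (fun p : PosField × PosField => step a θ u p.1 p.2) := by
  refine ContinuousMap.continuous_of_continuous_uncurry _ ?_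
  refine Continuous.subtype_mk ?_ _
  fun_prop

/-- The transition kernel of the recurrence with innovations of law `ν`: from the state `h`, the
next state is distributed as `step a θ u h z` with `z` of law `ν`. -/
def transitionKernel (a : Set.Ioo (0 : ℝ) 1) (θ : ℝ) (u : S2) (ν : Measure PosField) [SFinite ν] :
    Kernel PosField PosField where
  toFun h := ν.map (step a θ u h)
  measurable' := by
    have hm := (continuous_step a θ u).measurable
    have : (fun h : PosField => ν.map (step a θ u h)) =
        fun h => (ν.map (Prod.mk h)).map (fun p : PosField × PosField => step a θ u p.1 p.2) := by
      funext h
      rw [Measure.map_map hm measurable_prodMk_left]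
      rfl
    rw [this]
    exact (Measure.measurable_map _ hm).comp Measurable.map_prodMk_left

/-- The points `p 0, p 1, …` form a Poisson point process of intensity `Λ`: the number of points
in a measurable set `A` with `Λ A < ∞` has the Poisson law of parameter `Λ A`, and the numbers of
points in pairwise disjoint measurable sets are independent. -/
structure IsPoissonPointProcess {Ω E : Type*} [MeasurableSpace Ω] [MeasurableSpace E]
    (p : ℕ → Ω → E) (Λ : Measure E) (Pr : Measure Ω) : Prop where
  measurable (i : ℕ) : Measurable (p i)
  poisson (A : Set E) (hA : MeasurableSet A) (hfin : Λ A < ∞) (k : ℕ) :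
    Pr {ω | {i | p i ω ∈ A}.encard = k} = poissonMeasure (Λ A).toNNReal {k}
  indep (n : ℕ) (A : Fin n → Set E) (hA : ∀ j, MeasurableSet (A j))
    (hd : Pairwise fun j l => Disjoint (A j) (A l)) :
    iIndepFun (fun j ω => {i | p i ω ∈ A j}.encard) Pr

/-- The measure `u⁻² du` on `(0, ∞)`. -/
def invSqMeasure : Measure (Set.Ioi (0 : ℝ)) :=
  (Measure.comap Subtype.val (volume : Measure ℝ)).withDensity fun r => ENNReal.ofReal ((r : ℝ) ^ 2)⁻¹

/-- The field `x ↦ sup_i U_i f(x; M_i, κ)` in `[0, ∞]`. -/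
def spectralSup {Ω : Type*} (κ : ℝ) (U : ℕ → Ω → Set.Ioi (0 : ℝ)) (M : ℕ → Ω → S2) (x : S2)
    (ω : Ω) : ℝ≥0∞ :=
  ⨆ i, ENNReal.ofReal (U i ω * vonMisesFisher κ (M i ω) x)

/-- The random field `Z` is equal in distribution (for all finite-dimensional vectors) to
`x ↦ sup_i U_i f(x; M_i, κ)`. -/
def EqInDistribution {Ω Ω' : Type*} [MeasurableSpace Ω] [MeasurableSpace Ω'] (κ : ℝ)
    (Z : Ω → PosField) (Pr : Measure Ω) (U : ℕ → Ω' → Set.Ioi (0 : ℝ)) (M : ℕ → Ω' → S2)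
    (Pr' : Measure Ω') : Prop :=
  ∀ (n : ℕ) (x : Fin n → S2),
    IdentDistrib (fun ω k => ENNReal.ofReal (Z ω (x k))) (fun ω k => spectralSup κ U M (x k) ω)
      Pr Pr'

/-- The processes `X` and `Z` indexed by `ℤ` satisfy
`X(t, x) = max (a X(t - 1, R_{θ,u} x)) ((1 - a) Z(t, x))`, the innovation `Z(t, ·)` being
independent of the past `(X(s, ·))_{s < t}`. -/
structure IsMaxAutoregressive {Ω : Type*} [MeasurableSpace Ω] (a : Set.Ioo (0 : ℝ) 1) (θ : ℝ)
    (u : S2) (X Z : ℤ → Ω → PosField) (Pr : Measure Ω) : Prop where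
  measurable_state (t : ℤ) : Measurable (X t)
  measurable_innovation (t : ℤ) : Measurable (Z t)
  recurrence (t : ℤ) : ∀ᵐ ω ∂Pr, ∀ x : S2,
    (X t ω x : ℝ) = max (a * (X (t - 1) ω (sphereRotation θ u x) : ℝ)) ((1 - a) * (Z t ω x : ℝ))
  indep (t : ℤ) : IndepFun (Z t) (fun ω (s : Set.Iio t) => X s ω) Pr

/-- `X` is a Markov chain with transition kernel `P`: given the past `(X(s))_{s < t}`, the
conditional law of `X(t)` is `P (X(t - 1))`. -/
def IsMarkovChain {Ω E : Type*} [MeasurableSpace Ω] [MeasurableSpace E] (X : ℤ → Ω → E)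
    (P : Kernel E E) (Pr : Measure Ω) : Prop :=
  ∀ t : ℤ, HasCondDistrib (X t) (fun ω (s : Set.Iio t) => X s ω)
    (P.comap (fun y : Set.Iio t → E => y ⟨t - 1, by simp⟩) (measurable_pi_apply _)) Pr

/-- `L(h) = ‖h^γ‖_∞`. -/
def lyapunov (γ : ℝ) (h : PosField) : ℝ := ⨆ x : S2, (h x : ℝ) ^ γ

/-- The weighted supremum norm `‖φ‖_L = sup_h |φ(h)| / (1 + L(h))`, with values in `[0, ∞]`. -/
def weightedNorm (L φ : PosField → ℝ) : ℝ≥0∞ :=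
  ⨆ h : PosField, ENNReal.ofReal (|φ h| / (1 + L h))

end

/-!
The innovations are themselves the stationary law. Write `f(x; m, κ)` for the von Mises--Fisher
density. A field `Z` with the law `ν` of the innovations has the distribution functions
`ν {z | ∀ k, z (x k) ≤ y k} = exp (-V(x, y))`, where `V(x, y) = ∫ max_k f(x k; m, κ) / y k dm` is
the mean number of points of the Poisson process that exceed some threshold
(`EqInDistribution.isMaxStableLaw`). The function `V` is homogeneous of degree `-1` in `y`
(`exponentFn_div`) and unchanged when all the `x k` are rotated (`exponentFn_sphereRotation`), and
distribution functions determine a law on the space of fields (`posField_measure_ext`). Hence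
`max (a Z(R x)) ((1 - a) Z'(x))` has law `ν` again if `Z, Z'` are independent of law `ν`
(`IsMaxStableLaw.map_step`). So `ν` is invariant, and composing kernels of this form gives a kernel
of the same form: the `n`-step kernel from `h` is the law of the field
`max (a ^ n h(R' x)) ((1 - a ^ n) Z(x))` for a rotation `R'` (`IsMaxStableLaw.transitionKernel_pow`).

It remains to bound, for a kernel of this form with parameter `b = a ^ n`, the distance between the
transitions from `h` and from a stationary `h'`. Use the same innovation `z` for both. The next
states differ only if `b * max (h, h')` exceeds `(1 - b) * z` at some point, and then
`1 ≤ const * b ^ γ * (L(h) + L(h')) * z(x₀) ^ (-γ)`, because the density has bounded ratios and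
so almost surely any two values of `z` have ratio at most `exp (2 κ)` (`one_le_of_step_ne`,
`EqInDistribution.isHarnack`). Multiplying the difference of the observable by this bound gives the
factor `b ^ γ = (a ^ γ) ^ n` (`abs_sub_step_le`). What is left to integrate under `ν` are the powers
`z(x₀) ^ γ` and `z(x₀) ^ (-γ)`, finite since `z(x₀)` has a Fréchet law, so that it and its
inverse both have tails `O(1 / t)` (`integrable_rpow_of_tail`). Uniqueness follows by applying the
bound to indicator functions: the `n`-step probabilities of an event converge to its probability
under `ν`, and their mean under an invariant law does not depend on `n`
(`IsMaxStableLaw.eq_of_invariant`).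
-/

/-! ### Rotations of the sphere -/

theorem rotationMatrix_mul (θ θ' : ℝ) (u : S2) :
    rotationMatrix θ u.1.ofLp * rotationMatrix θ' u.1.ofLp = rotationMatrix (θ + θ') u.1.ofLp := by
  have hu : ‖u.1‖ ^ 2 = 1 := by rw [norm_eq_of_mem_sphere u]; norm_num
  rw [EuclideanSpace.norm_sq_eq, Fin.sum_univ_three] at hu
  simp only [Real.norm_eq_abs, sq_abs] at hu
  ext i j
  rw [Matrix.mul_apply, Fin.sum_univ_three]
  simp only [rotationMatrix, crossMatrix, Matrix.add_apply, Matrix.smul_apply,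
    Matrix.vecMulVec_apply, Matrix.one_apply, smul_eq_mul, Real.cos_add, Real.sin_add]
  generalize Real.cos θ = k at *
  generalize Real.sin θ = s at *
  generalize Real.cos θ' = k' at *
  generalize Real.sin θ' = s' at *
  have key : (1 - k) * (1 - k') * (u.1.ofLp i * u.1.ofLp j) *
      (u.1.ofLp 0 ^ 2 + u.1.ofLp 1 ^ 2 + u.1.ofLp 2 ^ 2) =
      (1 - k) * (1 - k') * (u.1.ofLp i * u.1.ofLp j) := by rw [hu, mul_one]
  generalize u.1.ofLp = w at *
  fin_cases i <;> fin_cases j <;> simp at key ⊢ <;>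
    first
    | linear_combination key
    | linear_combination key - s * s' * hu

theorem sphereRotation_apply_sphereRotation (θ θ' : ℝ) (u x : S2) :
    sphereRotation θ u (sphereRotation θ' u x) = sphereRotation (θ + θ') u x := by
  apply Subtype.ext
  simp only [sphereRotation, ContinuousMap.coe_mk, Matrix.mulVec_mulVec, rotationMatrix_mul]

/-- The rotation `R_{θ,u}`, as a linear isometry of the ambient space. -/
noncomputable def rotationIsometry (θ : ℝ) (u : S2) :
    EuclideanSpace ℝ (Fin 3) ≃ₗᵢ[ℝ] EuclideanSpace ℝ (Fin 3) :=
  LinearIsometry.toLinearIsometryEquiv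
    { toLinearMap := Matrix.toEuclideanLin (rotationMatrix θ u.1.ofLp)
      norm_map' := fun y => by
        rcases eq_or_ne y 0 with rfl | hy
        · simp
        have hy' : ‖y‖ ≠ 0 := norm_ne_zero_iff.2 hy
        have h1 : ‖Matrix.toEuclideanLin (rotationMatrix θ u.1.ofLp) (‖y‖⁻¹ • y)‖ = 1 :=
          norm_rotationMatrix_mulVec θ u ⟨‖y‖⁻¹ • y, by simp [norm_smul, hy']⟩
        rw [map_smul, norm_smul, norm_inv, norm_norm] at h1
        field_simp at h1
        exact h1 }
    rfl

theorem coe_sphereRotation (θ : ℝ) (u x : S2) :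
    (sphereRotation θ u x : EuclideanSpace ℝ (Fin 3)) = rotationIsometry θ u x := rfl

theorem vonMisesFisher_sphereRotation (κ θ : ℝ) (u m x : S2) :
    vonMisesFisher κ (sphereRotation θ u m) (sphereRotation θ u x) = vonMisesFisher κ m x := by
  simp only [vonMisesFisher, coe_sphereRotation, LinearIsometryEquiv.inner_map_map]

open scoped Pointwise in
theorem measurePreserving_sphereRotation (θ : ℝ) (u : S2) :
    MeasurePreserving (sphereRotation θ u) sphereMeasure sphereMeasure := by
  refine ⟨(sphereRotation θ u).continuous.measurable, ?_⟩
  ext s hs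
  rw [Measure.map_apply (sphereRotation θ u).continuous.measurable hs, sphereMeasure,
    Measure.toSphere_apply' _ hs,
    Measure.toSphere_apply' _ ((sphereRotation θ u).continuous.measurable hs)]
  congr 1
  symm
  rw [← (rotationIsometry θ u).measurePreserving.measure_preimage_emb
    (rotationIsometry θ u).toHomeomorph.measurableEmbedding]
  congr 1
  ext y
  simp only [Set.mem_smul, Set.mem_image, Set.mem_preimage]
  constructor
  · rintro ⟨r, hr, _, ⟨x, hx, rfl⟩, h⟩
    have hx' : sphereRotation θ u ⟨(rotationIsometry θ u).symm x, by simp⟩ = x :=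
      Subtype.ext (by simp [coe_sphereRotation])
    refine ⟨r, hr, _, ⟨⟨(rotationIsometry θ u).symm x, by simp⟩, ?_, rfl⟩, ?_⟩
    · rwa [hx']
    · apply (rotationIsometry θ u).injective
      simp [← h]
  · rintro ⟨r, hr, _, ⟨x, hx, rfl⟩, rfl⟩
    exact ⟨r, hr, _, ⟨_, hx, rfl⟩, by rw [map_smul]; rfl⟩

/-! ### The von Mises-Fisher density -/

theorem vonMisesFisher_pos {κ : ℝ} (hκ : 0 ≤ κ) (m x : S2) : 0 < vonMisesFisher κ m x := by
  rw [vonMisesFisher]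
  refine mul_pos ?_ (Real.exp_pos _)
  split_ifs with h
  · positivity
  · have := lt_of_le_of_ne hκ (Ne.symm h)
    have := Real.sinh_pos_iff.2 this
    positivity

theorem continuous_vonMisesFisher (κ : ℝ) (x : S2) : Continuous fun m => vonMisesFisher κ m x := by
  unfold vonMisesFisher
  fun_prop

theorem abs_inner_sphere_le_one (m x : S2) :
    |inner ℝ (m : EuclideanSpace ℝ (Fin 3)) (x : EuclideanSpace ℝ (Fin 3))| ≤ 1 := by
  have h := abs_real_inner_le_norm (m : EuclideanSpace ℝ (Fin 3)) x
  rwa [norm_eq_of_mem_sphere m, norm_eq_of_mem_sphere x, mul_one] at h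

/-- A Harnack inequality: two values of the density, for the same mean direction, have ratio at
most `exp (2 κ)`. -/
theorem vonMisesFisher_le_mul {κ : ℝ} (hκ : 0 ≤ κ) (m x y : S2) :
    vonMisesFisher κ m x ≤ Real.exp (2 * κ) * vonMisesFisher κ m y := by
  have hx := (abs_le.1 (abs_inner_sphere_le_one m x)).2
  have hy := (abs_le.1 (abs_inner_sphere_le_one m y)).1
  have hc := pos_of_mul_pos_left (vonMisesFisher_pos hκ m x) (Real.exp_pos _).le
  rw [vonMisesFisher, vonMisesFisher, mul_left_comm, ← Real.exp_add]
  refine mul_le_mul_of_nonneg_left (Real.exp_le_exp.2 ?_) hc.le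
  nlinarith [mul_le_mul_of_nonneg_left hx hκ, mul_le_mul_of_nonneg_left hy hκ]

/-! ### The exponent function of the max-stable field -/

theorem invSqMeasure_Ioi {t : ℝ} (ht : 0 < t) :
    invSqMeasure {r | t < (r : ℝ)} = ENNReal.ofReal (1 / t) := by
  have hm : MeasurableSet {r : Set.Ioi (0 : ℝ) | t < (r : ℝ)} :=
    measurableSet_lt measurable_const measurable_subtype_coe
  have himage : Subtype.val '' {r : Set.Ioi (0 : ℝ) | t < (r : ℝ)} = Set.Ioi t := by
    ext r
    simp only [Set.mem_image, Set.mem_ofPred_eq, Subtype.exists, Set.mem_Ioi, exists_and_left,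
      exists_prop, exists_eq_right_right]
    exact ⟨fun h => h.1, fun h => ⟨h, ht.trans h⟩⟩
  have hint := integrableOn_Ioi_rpow_of_lt (a := -2) (by norm_num) ht
  have hval := integral_Ioi_rpow_of_lt (a := -2) (by norm_num) ht
  have heq : ∀ r ∈ Set.Ioi t, ENNReal.ofReal (r ^ 2)⁻¹ = ENNReal.ofReal (r ^ (-2 : ℝ)) := by
    intro r hr
    rw [Real.rpow_neg (ht.trans hr).le]
    norm_num
  rw [invSqMeasure, withDensity_apply _ hm, setLIntegral_subtype measurableSet_Ioi
    {r : Set.Ioi (0 : ℝ) | t < (r : ℝ)} (fun r : ℝ => ENNReal.ofReal (r ^ 2)⁻¹), himage,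
    setLIntegral_congr_fun measurableSet_Ioi heq, ← ofReal_integral_eq_lintegral_ofReal hint, hval]
  · congr 1
    norm_num [Real.rpow_neg_one]
  · filter_upwards [ae_restrict_mem measurableSet_Ioi] with r hr
    exact Real.rpow_nonneg (ht.trans hr).le _

theorem invSqMeasure_exists_lt {n : ℕ} {t : Fin n → ℝ} (ht : ∀ k, 0 < t k) :
    invSqMeasure {r | ∃ k, t k < (r : ℝ)} = ⨆ k, ENNReal.ofReal (1 / t k) := by
  rcases isEmpty_or_nonempty (Fin n) with h | h
  · simp
  obtain ⟨k, hk⟩ := Finite.exists_min t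
  have : {r : Set.Ioi (0 : ℝ) | ∃ k, t k < (r : ℝ)} =
      {r : Set.Ioi (0 : ℝ) | t k < (r : ℝ)} := by
    ext r
    exact ⟨fun ⟨j, hj⟩ => (hk j).trans_lt hj, fun h => ⟨k, h⟩⟩
  rw [this, invSqMeasure_Ioi (ht k)]
  refine le_antisymm (le_iSup (fun k => ENNReal.ofReal (1 / t k)) k) (iSup_le fun j => ?_)
  exact ENNReal.ofReal_le_ofReal (one_div_le_one_div_of_le (ht k) (hk j))

instance : SFinite invSqMeasure := by
  have : SigmaFinite (Measure.comap (Subtype.val : Set.Ioi (0 : ℝ) → ℝ) volume) := by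
    refine SigmaFinite.of_map _ measurable_subtype_coe.aemeasurable ?_
    rw [(MeasurableEmbedding.subtype_coe measurableSet_Ioi).map_comap]
    infer_instance
  unfold invSqMeasure
  infer_instance

instance : IsFiniteMeasure sphereMeasure := by
  unfold sphereMeasure
  infer_instance

/-- The exponent function of the max-stable field `x ↦ sup_i U_i f(x; M_i, κ)`: the intensity of
the points `(r, m)` with `y k < r f(x k; m, κ)` for some `k`, in the form of an integral over `m`. -/
noncomputable def exponentFn (κ : ℝ) {n : ℕ} (x : Fin n → S2) (y : Fin n → ℝ) : ℝ≥0∞ :=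
  ∫⁻ m, ⨆ k, ENNReal.ofReal (vonMisesFisher κ m (x k) / y k) ∂sphereMeasure

theorem measurableSet_exceedance (κ : ℝ) {n : ℕ} (x : Fin n → S2) (y : Fin n → ℝ) :
    MeasurableSet {p : Set.Ioi (0 : ℝ) × S2 | ∃ k, y k < p.1 * vonMisesFisher κ p.2 (x k)} := by
  rw [Set.ofPred_exists]
  refine MeasurableSet.iUnion fun k => measurableSet_lt measurable_const ?_
  exact (measurable_subtype_coe.comp measurable_fst).mul
    ((continuous_vonMisesFisher κ (x k)).measurable.comp measurable_snd)

theorem intensity_exceedance {κ : ℝ} (hκ : 0 ≤ κ) {n : ℕ} (x : Fin n → S2) {y : Fin n → ℝ}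
    (hy : ∀ k, 0 < y k) :
    (invSqMeasure.prod sphereMeasure)
      {p | ∃ k, y k < p.1 * vonMisesFisher κ p.2 (x k)} = exponentFn κ x y := by
  rw [Measure.prod_apply_symm (measurableSet_exceedance κ x y), exponentFn]
  refine lintegral_congr fun m => ?_
  have hf := fun k => vonMisesFisher_pos hκ m (x k)
  have := invSqMeasure_exists_lt fun k => div_pos (hy k) (hf k)
  simp only [one_div_div] at this
  rw [← this]
  congr 1
  ext r
  simp [div_lt_iff₀ (hf _)]

theorem exponentFn_lt_top (κ : ℝ) {n : ℕ} (x : Fin n → S2) (y : Fin n → ℝ) :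
    exponentFn κ x y < ∞ := by
  have hc : ∀ k, Continuous fun m => vonMisesFisher κ m (x k) / y k := fun k =>
    (continuous_vonMisesFisher κ (x k)).div_const _
  calc exponentFn κ x y
      ≤ ∫⁻ m, ∑ k, ENNReal.ofReal (vonMisesFisher κ m (x k) / y k) ∂sphereMeasure :=
        lintegral_mono fun m => iSup_le fun k =>
          Finset.single_le_sum (f := fun k => ENNReal.ofReal (vonMisesFisher κ m (x k) / y k))
            (fun _ _ => zero_le) (Finset.mem_univ k)
    _ = ∑ k, ∫⁻ m, ENNReal.ofReal (vonMisesFisher κ m (x k) / y k) ∂sphereMeasure :=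
        lintegral_finsetSum _ fun k _ => (hc k).measurable.ennreal_ofReal
    _ < ∞ := by
        refine ENNReal.sum_lt_top.2 fun k _ => ?_
        exact ((hc k).integrable_of_hasCompactSupport
          (HasCompactSupport.of_compactSpace _)).lintegral_lt_top

theorem exponentFn_pos {κ : ℝ} (hκ : 0 ≤ κ) (x : S2) :
    0 < exponentFn κ (fun _ : Fin 1 => x) (fun _ => 1) := by
  simp only [exponentFn, ciSup_const, div_one]
  rw [lintegral_pos_iff_support (continuous_vonMisesFisher κ x).measurable.ennreal_ofReal]
  have : Function.support (fun m => ENNReal.ofReal (vonMisesFisher κ m x)) = Set.univ := by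
    ext m
    simp [vonMisesFisher_pos hκ m x]
  rw [this, Measure.measure_univ_pos]
  exact Measure.toSphere_ne_zero _

/-- The exponent function is homogeneous of degree `-1` in the thresholds. -/
theorem exponentFn_div (κ : ℝ) {n : ℕ} (x : Fin n → S2) (y : Fin n → ℝ) {c : ℝ} (hc : 0 < c) :
    exponentFn κ x (fun k => y k / c) = ENNReal.ofReal c * exponentFn κ x y := by
  rw [exponentFn, exponentFn, ← lintegral_const_mul']
  · refine lintegral_congr fun m => ?_
    rw [ENNReal.mul_iSup]
    refine iSup_congr fun k => ?_
    rw [← ENNReal.ofReal_mul hc.le]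
    congr 1
    field_simp
  · exact ENNReal.ofReal_ne_top

theorem exponentFn_sphereRotation (κ θ : ℝ) (u : S2) {n : ℕ} (x : Fin n → S2) (y : Fin n → ℝ) :
    exponentFn κ (fun k => sphereRotation θ u (x k)) y = exponentFn κ x y := by
  have hm : Measurable fun m => ⨆ k,
      ENNReal.ofReal (vonMisesFisher κ m (sphereRotation θ u (x k)) / y k) :=
    .iSup fun k => ((continuous_vonMisesFisher κ _).measurable.div_const _).ennreal_ofReal
  rw [exponentFn, ← (measurePreserving_sphereRotation θ u).lintegral_comp hm]
  simp only [vonMisesFisher_sphereRotation, exponentFn]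

/-! ### Laws on the space of fields and their finite-dimensional distributions -/

theorem measurable_eval_posField (x : S2) : Measurable fun z : PosField => (z x : ℝ) :=
  (continuous_subtype_val.comp (continuous_eval_const x)).measurable

theorem measurableSet_forall_le {n : ℕ} (x : Fin n → S2) (y : Fin n → ℝ) :
    MeasurableSet {z : PosField | ∀ k, (z (x k) : ℝ) ≤ y k} := by
  rw [Set.ofPred_forall]
  exact MeasurableSet.iInter fun k =>
    measurableSet_le (measurable_eval_posField (x k)) measurable_const

/-- The Borel `σ`-algebra of the space of fields is generated by the evaluations. -/
theorem borel_posField_le : borel PosField ≤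
    ⨆ x : S2, MeasurableSpace.comap (fun z : PosField => (z x : ℝ)) inferInstance := by
  set m := ⨆ x : S2, MeasurableSpace.comap (fun z : PosField => (z x : ℝ)) inferInstance with hm
  have heval : ∀ x, Measurable[m] fun z : PosField => (z x : ℝ) := fun x =>
    (comap_measurable _).mono (le_iSup (fun x : S2 =>
      MeasurableSpace.comap (fun z : PosField => (z x : ℝ)) inferInstance) x) le_rfl
  have hclosed : ∀ (g : PosField) (r : ℝ), 0 ≤ r →
      MeasurableSet[m] (Metric.closedBall g r) := by
    intro g r hr
    obtain ⟨D, hDc, hDd⟩ := TopologicalSpace.exists_countable_dense S2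
    have : Metric.closedBall g r = ⋂ x ∈ D, {z : PosField | |(z x : ℝ) - g x| ≤ r} := by
      ext z
      rw [Metric.mem_closedBall, ContinuousMap.dist_le hr, Set.mem_iInter₂]
      constructor
      · intro h x _
        exact h x
      · intro h x
        have hcl : IsClosed {x : S2 | dist (z x) (g x) ≤ r} :=
          isClosed_le (by fun_prop) continuous_const
        exact hcl.closure_subset_iff.2 (fun x hx => h x hx) (hDd x)
    rw [this]
    refine MeasurableSet.biInter hDc fun x _ => ?_
    have : Measurable[m] fun z : PosField => |(z x : ℝ) - g x| := by
      have h2 : Measurable fun s : ℝ => |s - g x| := by fun_prop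
      exact h2.comp (heval x)
    exact this measurableSet_Iic
  have hball : ∀ (g : PosField) (r : ℝ), MeasurableSet[m] (Metric.ball g r) := by
    intro g r
    have : Metric.ball g r = ⋃ k : ℕ, ⋃ _ : 0 ≤ r - 1 / (k + 1 : ℝ),
        Metric.closedBall g (r - 1 / (k + 1 : ℝ)) := by
      ext z
      simp only [Metric.mem_ball, Set.mem_iUnion, Metric.mem_closedBall, exists_prop]
      constructor
      · intro h
        obtain ⟨k, hk⟩ := exists_nat_one_div_lt (sub_pos.2 h)
        have := dist_nonneg (x := z) (y := g)
        exact ⟨k, by linarith, by linarith⟩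
      · rintro ⟨k, -, hk⟩
        have : 0 < 1 / (k + 1 : ℝ) := by positivity
        linarith
    rw [this]
    exact MeasurableSet.iUnion fun k => MeasurableSet.iUnion fun h => hclosed g _ h
  refine MeasurableSpace.generateFrom_le fun V hV => ?_
  change IsOpen V at hV
  obtain ⟨T, hTc, hT⟩ := TopologicalSpace.isOpen_iUnion_countable
    (fun p : {p : PosField × ℝ // Metric.ball p.1 p.2 ⊆ V} => Metric.ball p.1.1 p.1.2)
    fun _ => Metric.isOpen_ball
  have : V = ⋃ p ∈ T, Metric.ball p.1.1 p.1.2 := by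
    rw [hT]
    refine Set.Subset.antisymm (fun z hz => ?_) (Set.iUnion_subset fun p => p.2)
    obtain ⟨r, hr, hrV⟩ := Metric.isOpen_iff.1 hV z hz
    exact Set.mem_iUnion.2 ⟨⟨(z, r), hrV⟩, Metric.mem_ball_self hr⟩
  rw [this]
  exact MeasurableSet.biUnion hTc fun p _ => hball _ _

/-- Two probability measures on the space of fields with the same multivariate distribution
functions are equal. -/
theorem posField_measure_ext {ν₁ ν₂ : Measure PosField} [IsProbabilityMeasure ν₁]
    [IsProbabilityMeasure ν₂]
    (h : ∀ (n : ℕ) (x : Fin n → S2) (y : Fin n → ℝ), (∀ k, 0 < y k) →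
      ν₁ {z | ∀ k, (z (x k) : ℝ) ≤ y k} = ν₂ {z | ∀ k, (z (x k) : ℝ) ≤ y k}) : ν₁ = ν₂ := by
  set S : S2 → Set (Set PosField) := fun x =>
    Set.range fun y : ℝ => {z : PosField | (z x : ℝ) ≤ y} with hS
  have hgen : (inferInstance : MeasurableSpace PosField) =
      MeasurableSpace.generateFrom (piiUnionInter S Set.univ) := by
    refine le_antisymm (borel_posField_le.trans (iSup_le fun x => ?_)) ?_
    · rw [BorelSpace.measurable_eq (α := ℝ), borel_eq_generateFrom_Iic,
        MeasurableSpace.comap_generateFrom]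
      refine le_trans (MeasurableSpace.generateFrom_mono ?_)
        (le_generateFrom_piiUnionInter Set.univ (Set.mem_univ x))
      rintro _ ⟨_, ⟨y, rfl⟩, rfl⟩
      exact ⟨y, rfl⟩
    · refine generateFrom_piiUnionInter_le S (fun x => ?_) _
      refine MeasurableSpace.generateFrom_le ?_
      rintro _ ⟨y, rfl⟩
      exact measurableSet_le (measurable_eval_posField x) measurable_const
  have hpi : IsPiSystem (piiUnionInter S Set.univ) := by
    refine isPiSystem_piiUnionInter S (fun x => ?_) _
    rintro _ ⟨y, rfl⟩ _ ⟨y', rfl⟩ _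
    refine ⟨min y y', ?_⟩
    ext z
    simp
  refine ext_of_generate_finite _ hgen hpi ?_ (by simp)
  rintro _ ⟨t, -, f, hf, rfl⟩
  choose! y hy using hf
  by_cases hpos : ∀ x ∈ t, 0 < y x
  · let e : Fin t.card → S2 := fun k => (t.equivFin.symm k : t)
    have key := h t.card e (fun k => y (e k)) fun k => hpos _ (t.equivFin.symm k).2
    have : (⋂ x ∈ t, f x) = {z : PosField | ∀ k, (z (e k) : ℝ) ≤ y (e k)} := by
      ext z
      simp only [Set.mem_iInter, Set.mem_ofPred_eq]
      constructor
      · intro hz k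
        have := hz _ (t.equivFin.symm k).2
        rwa [← hy _ (t.equivFin.symm k).2] at this
      · intro hz x hx
        rw [← hy x hx]
        simpa [e] using hz (t.equivFin ⟨x, hx⟩)
    rw [this, key]
  · push Not at hpos
    obtain ⟨x, hx, hyx⟩ := hpos
    have : (⋂ x ∈ t, f x) = ∅ := by
      refine Set.eq_empty_of_forall_notMem fun z hz => ?_
      have := Set.mem_iInter₂.1 hz x hx
      rw [← hy x hx] at this
      exact absurd ((z x).2 : (0 : ℝ) < z x) (not_lt.2 (le_trans this hyx))
    simp [this]

/-! ### The law of the innovations -/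

/-- `ν` is the law of the max-stable field `x ↦ sup_i U_i f(x; M_i, κ)`, described by its
multivariate distribution functions. -/
def IsMaxStableLaw (κ : ℝ) (ν : Measure PosField) : Prop :=
  ∀ (n : ℕ) (x : Fin n → S2) (y : Fin n → ℝ), (∀ k, 0 < y k) →
    ν {z | ∀ k, (z (x k) : ℝ) ≤ y k} = ENNReal.ofReal (Real.exp (-(exponentFn κ x y).toReal))

theorem EqInDistribution.isMaxStableLaw {κ : ℝ} (hκ : 0 ≤ κ)
    {Ω' : Type*} [MeasurableSpace Ω'] {Pr' : Measure Ω'}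
    {U : ℕ → Ω' → Set.Ioi (0 : ℝ)} {M : ℕ → Ω' → S2}
    (hUM : IsPoissonPointProcess (fun i ω => (U i ω, M i ω)) (invSqMeasure.prod sphereMeasure) Pr')
    {Ω : Type*} [MeasurableSpace Ω] {Pr : Measure Ω} {Z : Ω → PosField} (hm : Measurable Z)
    (hZ : EqInDistribution κ Z Pr U M Pr') : IsMaxStableLaw κ (Pr.map Z) := by
  intro n x y hy
  set A := {p : Set.Ioi (0 : ℝ) × S2 | ∃ k, y k < p.1 * vonMisesFisher κ p.2 (x k)} with hA
  have hΛ : (invSqMeasure.prod sphereMeasure) A = exponentFn κ x y := intensity_exceedance hκ x hy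
  have hB : MeasurableSet {v : Fin n → ℝ≥0∞ | ∀ k, v k ≤ ENNReal.ofReal (y k)} := by
    rw [Set.ofPred_forall]
    exact MeasurableSet.iInter fun k => measurableSet_le (measurable_pi_apply k) measurable_const
  have h1 := (hZ n x).measure_mem_eq hB
  have hp := hUM.poisson A (measurableSet_exceedance κ x y)
    (hΛ ▸ exponentFn_lt_top κ x y) 0
  rw [hΛ, poissonMeasure_singleton] at hp
  rw [Measure.map_apply hm (measurableSet_forall_le x y)]
  have hl : (fun ω k => ENNReal.ofReal (Z ω (x k))) ⁻¹'
      {v : Fin n → ℝ≥0∞ | ∀ k, v k ≤ ENNReal.ofReal (y k)} =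
      Z ⁻¹' {z | ∀ k, (z (x k) : ℝ) ≤ y k} := by
    ext ω
    simp [ENNReal.ofReal_le_ofReal_iff (hy _).le]
  have hr : (fun ω k => spectralSup κ U M (x k) ω) ⁻¹'
      {v : Fin n → ℝ≥0∞ | ∀ k, v k ≤ ENNReal.ofReal (y k)} =
      {ω | {i | (U i ω, M i ω) ∈ A}.encard = ((0 : ℕ) : ℕ∞)} := by
    ext ω
    simp only [spectralSup, Set.mem_preimage, Set.mem_ofPred_eq, iSup_le_iff,
      ENNReal.ofReal_le_ofReal_iff (hy _).le, Nat.cast_zero, Set.encard_eq_zero,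
      Set.eq_empty_iff_forall_notMem, hA, not_exists, not_lt]
    exact forall_comm
  rw [← hl, h1, hr, hp]
  simp [ENNReal.coe_toNNReal_eq_toReal]

/-- There is only one law of the max-stable field, so all innovations have the same law. -/
theorem IsMaxStableLaw.eq {κ : ℝ} {ν₁ ν₂ : Measure PosField} [IsProbabilityMeasure ν₁]
    [IsProbabilityMeasure ν₂] (h₁ : IsMaxStableLaw κ ν₁) (h₂ : IsMaxStableLaw κ ν₂) : ν₁ = ν₂ :=
  posField_measure_ext fun n x y hy => (h₁ n x y hy).trans (h₂ n x y hy).symm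

/-- Scaling a field of the max-stable law by `c` multiplies its exponent function by `c`. -/
theorem IsMaxStableLaw.measure_mul_le {κ : ℝ} {ν : Measure PosField} (h : IsMaxStableLaw κ ν)
    {c : ℝ} (hc : 0 < c) {n : ℕ} (x : Fin n → S2) {y : Fin n → ℝ} (hy : ∀ k, 0 < y k) :
    ν {z | ∀ k, c * (z (x k) : ℝ) ≤ y k} =
      ENNReal.ofReal (Real.exp (-(c * (exponentFn κ x y).toReal))) := by
  have := h n x (fun k => y k / c) fun k => div_pos (hy k) hc
  simp only [le_div_iff₀' hc] at this
  rw [this, exponentFn_div κ x y hc, ENNReal.toReal_mul, ENNReal.toReal_ofReal hc.le]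

/-- The Harnack inequality with constant `H` for the fields of law `ν`: almost surely, any two
values of the field have ratio at most `H`. -/
def IsHarnack (H : ℝ) (ν : Measure PosField) : Prop :=
  ∀ᵐ z ∂ν, ∀ x y : S2, (z x : ℝ) ≤ H * z y

theorem EqInDistribution.isHarnack {κ : ℝ} (hκ : 0 ≤ κ)
    {Ω' : Type*} [MeasurableSpace Ω'] {Pr' : Measure Ω'}
    {U : ℕ → Ω' → Set.Ioi (0 : ℝ)} {M : ℕ → Ω' → S2}
    {Ω : Type*} [MeasurableSpace Ω] {Pr : Measure Ω} {Z : Ω → PosField} (hm : Measurable Z)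
    (hZ : EqInDistribution κ Z Pr U M Pr') :
    IsHarnack (Real.exp (2 * κ)) (Pr.map Z) := by
  have hpair : ∀ x y : S2, ∀ᵐ z ∂(Pr.map Z), (z x : ℝ) ≤ Real.exp (2 * κ) * z y := by
    intro x y
    rw [ae_map_iff hm.aemeasurable (measurableSet_le (measurable_eval_posField x)
      ((measurable_eval_posField y).const_mul _))]
    have hB : MeasurableSet {v : Fin 2 → ℝ≥0∞ | v 0 ≤ ENNReal.ofReal (Real.exp (2 * κ)) * v 1} :=
      measurableSet_le (measurable_pi_apply 0) ((measurable_pi_apply 1).const_mul _)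
    have h := (hZ 2 ![x, y]).symm.ae_snd hB (Filter.Eventually.of_forall fun ω => ?_)
    · filter_upwards [h] with ω hω
      rw [← ENNReal.ofReal_mul (Real.exp_pos _).le, ENNReal.ofReal_le_ofReal_iff] at hω
      · exact hω
      · exact mul_nonneg (Real.exp_pos _).le (Z ω y).2.le
    · simp only [spectralSup, ENNReal.mul_iSup]
      refine iSup_mono fun i => ?_
      rw [← ENNReal.ofReal_mul (Real.exp_pos _).le, mul_left_comm]
      exact ENNReal.ofReal_le_ofReal
        (mul_le_mul_of_nonneg_left (vonMisesFisher_le_mul hκ _ _ _) (U i ω).2.le)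
  -- a countable dense set of pairs suffices, by continuity of the fields
  obtain ⟨D, hDc, hDd⟩ := TopologicalSpace.exists_countable_dense (S2 × S2)
  have hD := (ae_ball_iff hDc).2 fun p _ => hpair p.1 p.2
  filter_upwards [hD] with z hz x y
  have hcl : IsClosed {p : S2 × S2 | (z p.1 : ℝ) ≤ Real.exp (2 * κ) * z p.2} :=
    isClosed_le (by fun_prop) (by fun_prop)
  exact hcl.closure_subset_iff.2 (fun p hp => hz p hp) (hDd (x, y))

/-! ### Moments -/

/-- A nonnegative function with tails `O(1 / t)` has finite moments of all orders below one. -/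
theorem integrable_rpow_of_tail {α : Type*} [MeasurableSpace α] {μ : Measure α}
    [IsProbabilityMeasure μ] {f : α → ℝ} (hf : Measurable f) (hf0 : ∀ ω, 0 ≤ f ω) {C : ℝ}
    (htail : ∀ t : ℝ, 0 < t → μ {ω | t ≤ f ω} ≤ ENNReal.ofReal (C / t)) {γ : ℝ} (hγ : 0 < γ)
    (hγ1 : γ < 1) : Integrable (fun ω => f ω ^ γ) μ := by
  refine ⟨(hf.pow_const γ).aestronglyMeasurable, ?_⟩
  rw [hasFiniteIntegral_iff_ofReal
      (Filter.Eventually.of_forall fun ω => Real.rpow_nonneg (hf0 ω) γ),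
    lintegral_rpow_eq_lintegral_meas_le_mul μ (Filter.Eventually.of_forall hf0) hf.aemeasurable hγ]
  refine ENNReal.mul_lt_top ENNReal.ofReal_lt_top ?_
  -- below one the tail is at most `1`, above one it is at most `C / t`
  rw [← Set.Ioc_union_Ioi_eq_Ioi zero_le_one]
  refine (lintegral_union_le _ _ _).trans_lt (ENNReal.add_lt_top.2 ⟨?_, ?_⟩)
  · have hint : IntegrableOn (fun t : ℝ => t ^ (γ - 1)) (Set.Ioc 0 1) :=
      (intervalIntegrable_iff_integrableOn_Ioc_of_le zero_le_one).1
        (intervalIntegral.intervalIntegrable_rpow' (by linarith))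
    refine lt_of_le_of_lt ?_ hint.lintegral_lt_top
    exact lintegral_mono fun t => mul_le_of_le_one_left zero_le prob_le_one
  · have hint : IntegrableOn (fun t : ℝ => C * t ^ (γ - 2)) (Set.Ioi 1) :=
      (integrableOn_Ioi_rpow_of_lt (by linarith) one_pos).const_mul C
    refine lt_of_le_of_lt ?_ hint.lintegral_lt_top
    refine setLIntegral_mono' measurableSet_Ioi fun t (ht : 1 < t) => ?_
    have ht0 : 0 < t := one_pos.trans ht
    refine (mul_le_mul_left (htail t ht0) _).trans_eq ?_
    rw [← ENNReal.ofReal_mul' (Real.rpow_nonneg ht0.le _)]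
    congr 1
    rw [show γ - 1 = (γ - 2) + 1 by ring, Real.rpow_add ht0, Real.rpow_one]
    field_simp

theorem IsMaxStableLaw.measure_eval_le {κ : ℝ} {ν : Measure PosField}
    (h : IsMaxStableLaw κ ν) (x : S2) {t : ℝ} (ht : 0 < t) :
    ν {z | (z x : ℝ) ≤ t} = ENNReal.ofReal
      (Real.exp (-((exponentFn κ (fun _ : Fin 1 => x) (fun _ => 1)).toReal / t))) := by
  have := h.measure_mul_le (inv_pos.2 ht) (fun _ : Fin 1 => x) (y := fun _ => 1)
    fun _ => one_pos
  simp only [forall_const, inv_mul_le_iff₀ ht, mul_one] at this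
  rw [this, inv_mul_eq_div]

theorem IsMaxStableLaw.integrable_rpow {κ : ℝ} {ν : Measure PosField} [IsProbabilityMeasure ν]
    (h : IsMaxStableLaw κ ν) (x : S2) {γ : ℝ} (hγ : 0 < γ)
    (hγ1 : γ < 1) : Integrable (fun z : PosField => (z x : ℝ) ^ γ) ν := by
  set c := (exponentFn κ (fun _ : Fin 1 => x) (fun _ => 1)).toReal with hc
  refine integrable_rpow_of_tail (C := 2 * c) (measurable_eval_posField x) (fun z => (z x).2.le)
    (fun t ht => ?_) hγ hγ1
  have hms : MeasurableSet {z : PosField | (z x : ℝ) ≤ t / 2} :=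
    measurableSet_le (measurable_eval_posField x) measurable_const
  calc ν {z | t ≤ (z x : ℝ)} ≤ ν {z | (z x : ℝ) ≤ t / 2}ᶜ :=
        measure_mono fun z (hz : t ≤ (z x : ℝ)) => by
          simp only [Set.mem_compl_iff, Set.mem_ofPred_eq, not_le]
          linarith
    _ = 1 - ENNReal.ofReal (Real.exp (-(c / (t / 2)))) := by
        rw [measure_compl hms (measure_ne_top _ _), measure_univ,
          h.measure_eval_le x (half_pos ht)]
    _ ≤ ENNReal.ofReal (2 * c / t) := by
        rw [← ENNReal.ofReal_one, ← ENNReal.ofReal_sub _ (Real.exp_pos _).le]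
        refine ENNReal.ofReal_le_ofReal ?_
        have := Real.add_one_le_exp (-(c / (t / 2)))
        have : c / (t / 2) = 2 * c / t := by field_simp
        linarith

theorem IsMaxStableLaw.integrable_inv_rpow {κ : ℝ} {ν : Measure PosField} [IsProbabilityMeasure ν]
    (hκ : 0 ≤ κ) (h : IsMaxStableLaw κ ν) (x : S2) {γ : ℝ}
    (hγ : 0 < γ) (hγ1 : γ < 1) : Integrable (fun z : PosField => ((z x : ℝ) ^ γ)⁻¹) ν := by
  set c := (exponentFn κ (fun _ : Fin 1 => x) (fun _ => 1)).toReal with hc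
  have hc0 : 0 < c := ENNReal.toReal_pos (exponentFn_pos hκ x).ne' (exponentFn_lt_top _ _ _).ne
  have := integrable_rpow_of_tail (μ := ν) (f := fun z : PosField => (z x : ℝ)⁻¹) (C := 1 / c)
    (measurable_eval_posField x).inv (fun z => inv_nonneg.2 (z x).2.le) (fun t ht => ?_) hγ hγ1
  · refine this.congr (Filter.Eventually.of_forall fun z => ?_)
    exact Real.inv_rpow (z x).2.le γ
  · have : {z : PosField | t ≤ (z x : ℝ)⁻¹} = {z : PosField | (z x : ℝ) ≤ t⁻¹} := by
      ext z
      exact le_inv_comm₀ ht (z x).2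
    rw [this, h.measure_eval_le x (inv_pos.2 ht)]
    refine ENNReal.ofReal_le_ofReal ?_
    -- `exp (-s) ≤ 1 / s`
    rw [← hc, div_inv_eq_mul, Real.exp_neg, div_div, one_div]
    refine inv_anti₀ (by positivity) ?_
    linarith [Real.add_one_le_exp (c * t)]

/-! ### The transition kernel and its iterates -/

theorem measurable_step (a : Set.Ioo (0 : ℝ) 1) (θ : ℝ) (u : S2) :
    Measurable fun p : PosField × PosField => step a θ u p.1 p.2 :=
  (continuous_step a θ u).measurable

theorem measurable_step_right (a : Set.Ioo (0 : ℝ) 1) (θ : ℝ) (u : S2) (h : PosField) :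
    Measurable (step a θ u h) :=
  (measurable_step a θ u).comp measurable_prodMk_left

theorem coe_step (a : Set.Ioo (0 : ℝ) 1) (θ : ℝ) (u : S2) (h z : PosField) (x : S2) :
    (step a θ u h z x : ℝ) =
      max (a * (h (sphereRotation θ u x) : ℝ)) ((1 - a) * (z x : ℝ)) := rfl

theorem transitionKernel_apply (a : Set.Ioo (0 : ℝ) 1) (θ : ℝ) (u : S2) (ν : Measure PosField)
    [SFinite ν] (h : PosField) : transitionKernel a θ u ν h = ν.map (step a θ u h) := rfl

instance (a : Set.Ioo (0 : ℝ) 1) (θ : ℝ) (u : S2) (ν : Measure PosField)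
    [IsProbabilityMeasure ν] : IsMarkovKernel (transitionKernel a θ u ν) :=
  ⟨fun h => Measure.isProbabilityMeasure_map (measurable_step_right a θ u h).aemeasurable⟩

theorem bind_transitionKernel (a : Set.Ioo (0 : ℝ) 1) (θ : ℝ) (u : S2) (μ ν : Measure PosField)
    [SFinite ν] :
    μ.bind (transitionKernel a θ u ν) = (μ.prod ν).map fun p => step a θ u p.1 p.2 := by
  ext s hs
  rw [Measure.bind_apply hs (Kernel.aemeasurable _), Measure.map_apply (measurable_step a θ u) hs,
    Measure.prod_apply (measurable_step a θ u hs)]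
  refine lintegral_congr fun h => ?_
  rw [transitionKernel_apply, Measure.map_apply (measurable_step_right a θ u h) hs]
  rfl

/-- Max-stability and isotropy: with `Z, Z'` independent of the max-stable law, the field
`x ↦ max (a Z(R x)) ((1 - a) Z'(x))` has the same law. -/
theorem IsMaxStableLaw.map_step {κ : ℝ} {ν : Measure PosField} [IsProbabilityMeasure ν]
    (h : IsMaxStableLaw κ ν) (a : Set.Ioo (0 : ℝ) 1) (θ : ℝ) (u : S2) :
    ((ν.prod ν).map fun p => step a θ u p.1 p.2) = ν := by
  have : IsProbabilityMeasure ((ν.prod ν).map fun p => step a θ u p.1 p.2) :=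
    Measure.isProbabilityMeasure_map (measurable_step a θ u).aemeasurable
  have ha := a.2.1
  have ha' : 0 < 1 - (a : ℝ) := sub_pos.2 a.2.2
  refine posField_measure_ext fun n x y hy => ?_
  -- the two factors are independent: `exp (-a V) * exp (-(1 - a) V) = exp (-V)`
  have hset : (fun p : PosField × PosField => step a θ u p.1 p.2) ⁻¹'
        {z | ∀ k, (z (x k) : ℝ) ≤ y k} =
      {z : PosField | ∀ k, a * (z (sphereRotation θ u (x k)) : ℝ) ≤ y k} ×ˢ
        {z : PosField | ∀ k, (1 - a) * (z (x k) : ℝ) ≤ y k} := by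
    ext p
    simp only [Set.mem_preimage, Set.mem_ofPred_eq, coe_step, max_le_iff, Set.mem_prod, forall_and]
  rw [Measure.map_apply (measurable_step a θ u) (measurableSet_forall_le x y), hset,
    Measure.prod_prod, h.measure_mul_le ha _ hy, h.measure_mul_le ha' _ hy,
    exponentFn_sphereRotation, ← ENNReal.ofReal_mul (Real.exp_pos _).le, ← Real.exp_add,
    h n x y hy]
  congr 2
  ring

theorem IsMaxStableLaw.invariant {κ : ℝ} {ν : Measure PosField} [IsProbabilityMeasure ν]
    (h : IsMaxStableLaw κ ν) (a : Set.Ioo (0 : ℝ) 1) (θ : ℝ) (u : S2) :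
    (transitionKernel a θ u ν).Invariant ν := by
  rw [Kernel.Invariant, bind_transitionKernel, h.map_step]

/-- Two consecutive steps are one step with parameter `a a'`, angle `θ + θ'` and an innovation
that is itself a step applied to the two innovations. -/
theorem step_step (a a' : Set.Ioo (0 : ℝ) 1) (θ θ' : ℝ) (u : S2)
    (h z z' : PosField) (c : Set.Ioo (0 : ℝ) 1) (hc : (c : ℝ) * (1 - a * a') = a' * (1 - a)) :
    step a' θ' u (step a θ u h z) z' =
      step (a * a') (θ + θ') u h (step c θ' u z z') := by
  have ha' := a'.2.1.le
  have h1 : 0 ≤ 1 - ((a : ℝ) * a') := by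
    nlinarith [a.2.1, a.2.2, a'.2.1, a'.2.2]
  ext x
  rw [coe_step, coe_step, coe_step, coe_step, Set.Ioo.coe_mul, sphereRotation_apply_sphereRotation,
    mul_max_of_nonneg _ _ ha', mul_max_of_nonneg _ _ h1, max_assoc]
  congr 1
  · ring
  · congr 1
    · linear_combination (-(z (sphereRotation θ' u x) : ℝ)) * hc
    · linear_combination (z' x : ℝ) * hc

theorem IsMaxStableLaw.transitionKernel_comp {κ : ℝ} {ν : Measure PosField}
    [IsProbabilityMeasure ν] (h : IsMaxStableLaw κ ν) (a a' : Set.Ioo (0 : ℝ) 1) (θ θ' : ℝ)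
    (u : S2) :
    transitionKernel a' θ' u ν ∘ₖ transitionKernel a θ u ν =
      transitionKernel (a * a') (θ + θ') u ν := by
  have haa : (a : ℝ) * a' < 1 := (a * a').2.2
  have hlt : (a' : ℝ) * (1 - a) < 1 - a * a' := by linarith [a'.2.2]
  let c : Set.Ioo (0 : ℝ) 1 := ⟨a' * (1 - a) / (1 - a * a'),
    div_pos (mul_pos a'.2.1 (sub_pos.2 a.2.2)) (sub_pos.2 haa),
    (div_lt_one (sub_pos.2 haa)).2 hlt⟩
  have hc : (c : ℝ) * (1 - a * a') = a' * (1 - a) := div_mul_cancel₀ _ (sub_pos.2 haa).ne'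
  ext1 f
  have hprod : (ν.map (step a θ u f)).prod ν =
      (ν.prod ν).map (Prod.map (step a θ u f) id) := by
    rw [← Measure.map_prod_map _ _ (measurable_step_right a θ u f) measurable_id, Measure.map_id]
  rw [Kernel.comp_apply, bind_transitionKernel, transitionKernel_apply, transitionKernel_apply,
    hprod, Measure.map_map (measurable_step a' θ' u)
      ((measurable_step_right a θ u f).prodMap measurable_id)]
  conv_rhs => rw [← h.map_step c θ' u]
  rw [Measure.map_map (measurable_step_right _ _ u f) (measurable_step c θ' u)]
  congr 1
  ext1 p
  exact step_step a a' θ θ' u f p.1 p.2 c hc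

/-- The `n`-step transition probabilities have the same form as the one-step ones. -/
theorem IsMaxStableLaw.transitionKernel_pow {κ : ℝ} {ν : Measure PosField}
    [IsProbabilityMeasure ν] (h : IsMaxStableLaw κ ν) (a : Set.Ioo (0 : ℝ) 1) (θ : ℝ)
    (u : S2) (n : ℕ) : ∃ (b : Set.Ioo (0 : ℝ) 1) (θ' : ℝ), (b : ℝ) = (a : ℝ) ^ (n + 1) ∧
      transitionKernel a θ u ν ^ (n + 1) = transitionKernel b θ' u ν := by
  induction n with
  | zero => exact ⟨a, θ, by simp, by simp⟩
  | succ n ih =>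
    obtain ⟨b, θ', hb, hP⟩ := ih
    refine ⟨a * b, θ + θ', by rw [Set.Ioo.coe_mul, hb, ← pow_succ'], ?_⟩
    rw [pow_succ, hP, ← h.transitionKernel_comp]
    rfl

/-! ### The Markov property -/

theorem IsMaxAutoregressive.isMarkovChain {Ω : Type*} [MeasurableSpace Ω] {Pr : Measure Ω}
    [IsProbabilityMeasure Pr] {a : Set.Ioo (0 : ℝ) 1} {θ : ℝ} {u : S2} {X Z : ℤ → Ω → PosField}
    (hXZ : IsMaxAutoregressive a θ u X Z Pr) {ν : Measure PosField} [SFinite ν]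
    (hν : ∀ t, Pr.map (Z t) = ν) : IsMarkovChain X (transitionKernel a θ u ν) Pr := by
  intro t
  have hX := hXZ.measurable_state
  have hZ := hXZ.measurable_innovation
  have hpast : Measurable fun ω (s : Set.Iio t) => X s ω :=
    measurable_pi_lambda _ fun s => hX s
  refine ⟨(hpast.prodMk (hX t)).aemeasurable, ?_⟩
  let G : (Set.Iio t → PosField) × PosField → (Set.Iio t → PosField) × PosField :=
    fun p => (p.1, step a θ u (p.1 ⟨t - 1, by simp⟩) p.2)
  have hproj : Measurable fun p : (Set.Iio t → PosField) × PosField =>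
      (p.1 ⟨t - 1, by simp⟩, p.2) :=
    ((measurable_pi_apply _).comp measurable_fst).prodMk measurable_snd
  have hG : Measurable G := measurable_fst.prodMk ((measurable_step a θ u).comp hproj)
  have hae : (fun ω => ((fun s : Set.Iio t => X s ω), X t ω)) =ᵐ[Pr]
      G ∘ fun ω => ((fun s : Set.Iio t => X s ω), Z t ω) := by
    filter_upwards [hXZ.recurrence t] with ω hω
    refine Prod.ext rfl ?_
    ext x
    exact hω x
  have hind := (indepFun_iff_map_prod_eq_prod_map_map hpast.aemeasurable
    (hZ t).aemeasurable).1 (hXZ.indep t).symm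
  rw [Measure.map_congr hae, ← Measure.map_map hG (hpast.prodMk (hZ t)), hind, hν t]
  have : IsProbabilityMeasure (Pr.map fun ω (s : Set.Iio t) => X s ω) :=
    Measure.isProbabilityMeasure_map hpast.aemeasurable
  have : IsProbabilityMeasure ν := by
    rw [← hν 0]
    exact Measure.isProbabilityMeasure_map (hZ 0).aemeasurable
  ext s hs
  rw [Measure.map_apply hG hs, Measure.prod_apply (hG hs), Measure.compProd_apply hs]
  refine lintegral_congr fun y => ?_
  rw [Kernel.comap_apply, transitionKernel_apply,
    Measure.map_apply (measurable_step_right a θ u _) (measurable_prodMk_left hs)]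
  rfl

/-! ### The Lyapunov function -/

instance : Nonempty S2 :=
  ((NormedSpace.sphere_nonempty (x := (0 : EuclideanSpace ℝ (Fin 3)))).2 zero_le_one).to_subtype

theorem rpow_le_lyapunov {γ : ℝ} (hγ : 0 < γ) (h : PosField) (x : S2) :
    (h x : ℝ) ^ γ ≤ lyapunov γ h := by
  have hc : Continuous fun x : S2 => (h x : ℝ) ^ γ :=
    (continuous_subtype_val.comp h.continuous).rpow_const fun _ => Or.inr hγ.le
  exact le_ciSup (isCompact_range hc).bddAbove x

theorem lyapunov_nonneg (γ : ℝ) (h : PosField) : 0 ≤ lyapunov γ h :=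
  Real.iSup_nonneg fun x => Real.rpow_nonneg (h x).2.le γ

theorem lyapunov_le_of_le_mul {γ : ℝ} (hγ : 0 < γ) {h : PosField} {x₀ : S2} {H : ℝ} (hH : 0 < H)
    (hh : ∀ x y, (h x : ℝ) ≤ H * h y) : lyapunov γ h ≤ H ^ γ * (h x₀ : ℝ) ^ γ :=
  ciSup_le fun x => by
    rw [← Real.mul_rpow hH.le (h x₀).2.le]
    exact Real.rpow_le_rpow (h x).2.le (hh x x₀) hγ.le

theorem lyapunov_step_le {γ : ℝ} (hγ : 0 < γ) (b : Set.Ioo (0 : ℝ) 1) (θ : ℝ) (u : S2)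
    (h z : PosField) :
    lyapunov γ (step b θ u h z) ≤ (b : ℝ) ^ γ * lyapunov γ h + lyapunov γ z := by
  have hb := b.2.1.le
  refine ciSup_le fun x => ?_
  have h1 : (b * (h (sphereRotation θ u x) : ℝ)) ^ γ ≤ (b : ℝ) ^ γ * lyapunov γ h := by
    rw [Real.mul_rpow hb (h _).2.le]
    exact mul_le_mul_of_nonneg_left (rpow_le_lyapunov hγ h _) (Real.rpow_nonneg hb γ)
  have h2 : ((1 - b) * (z x : ℝ)) ^ γ ≤ lyapunov γ z := by
    have hz : (0 : ℝ) < z x := (z x).2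
    refine (Real.rpow_le_rpow (mul_nonneg (sub_nonneg.2 b.2.2.le) hz.le) ?_ hγ.le).trans
      (rpow_le_lyapunov hγ z x)
    nlinarith [b.2.1]
  have h3 := mul_nonneg (Real.rpow_nonneg hb γ) (lyapunov_nonneg γ h)
  have h4 := lyapunov_nonneg γ z
  rw [coe_step]
  rcases max_choice (b * (h (sphereRotation θ u x) : ℝ)) ((1 - b) * (z x : ℝ)) with e | e <;>
    rw [e] <;> linarith

/-! ### Coupling by common innovations -/

/-- If the next states from `h` and from `h'` with the same innovation `z` differ, then the past
has exceeded the innovation somewhere, so that the minimum of `z` is at most a multiple of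
`b * max (sup h) (sup h')`. -/
theorem one_le_of_step_ne {γ : ℝ} (hγ : 0 < γ) {b : Set.Ioo (0 : ℝ) 1} {θ : ℝ} {u : S2}
    {h h' z : PosField} (hne : step b θ u h z ≠ step b θ u h' z) {δ : ℝ} (hδ : 0 < δ)
    (hδb : δ ≤ 1 - b) {x₀ : S2} {H : ℝ} (hH : 0 < H) (hz : ∀ x y, (z x : ℝ) ≤ H * z y) :
    1 ≤ (b : ℝ) ^ γ * (lyapunov γ h + lyapunov γ h') * ((H / δ) ^ γ * ((z x₀ : ℝ) ^ γ)⁻¹) := by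
  have hb := b.2.1.le
  have hw : (0 : ℝ) < z x₀ := (z x₀).2
  -- where the past does not exceed the innovation, both next states equal `(1 - b) * z`
  have hexc : ∃ x, (1 - b) * (z x : ℝ) < b * (h (sphereRotation θ u x) : ℝ) ∨
      (1 - b) * (z x : ℝ) < b * (h' (sphereRotation θ u x) : ℝ) := by
    by_contra! hle
    refine hne ?_
    ext x
    rw [coe_step, coe_step, max_eq_right (hle x).1, max_eq_right (hle x).2]
  have hkey : ∀ (g : PosField) (x : S2),
      (1 - b) * (z x : ℝ) < (b : ℝ) * (g (sphereRotation θ u x) : ℝ) →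
      1 ≤ (b : ℝ) ^ γ * lyapunov γ g * ((H / δ) ^ γ * ((z x₀ : ℝ) ^ γ)⁻¹) := by
    intro g x hx
    have h1 : 1 ≤ (b : ℝ) * (g (sphereRotation θ u x) : ℝ) * (H / δ * (z x₀ : ℝ)⁻¹) := by
      have h2 : δ * (z x₀ : ℝ) ≤ H * ((b : ℝ) * (g (sphereRotation θ u x) : ℝ)) := by
        have hzx : (0 : ℝ) < z x := (z x).2
        nlinarith [hz x₀ x, mul_le_mul_of_nonneg_right hδb hzx.le]
      rw [show (b : ℝ) * (g (sphereRotation θ u x) : ℝ) * (H / δ * (z x₀ : ℝ)⁻¹) =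
        H * ((b : ℝ) * (g (sphereRotation θ u x) : ℝ)) / (δ * (z x₀ : ℝ)) by field_simp,
        one_le_div (mul_pos hδ hw)]
      exact h2
    have hg : (0 : ℝ) < g (sphereRotation θ u x) := (g _).2
    have h3 := Real.one_le_rpow h1 hγ.le
    rw [Real.mul_rpow (by positivity) (by positivity), Real.mul_rpow hb hg.le,
      Real.mul_rpow (by positivity) (by positivity), Real.inv_rpow hw.le] at h3
    refine h3.trans ?_
    gcongr
    exact rpow_le_lyapunov hγ g _
  have hmono : ∀ s t : ℝ, s ≤ t → (b : ℝ) ^ γ * s * ((H / δ) ^ γ * ((z x₀ : ℝ) ^ γ)⁻¹) ≤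
      (b : ℝ) ^ γ * t * ((H / δ) ^ γ * ((z x₀ : ℝ) ^ γ)⁻¹) := fun s t hst => by gcongr
  obtain ⟨x, hx | hx⟩ := hexc
  · exact (hkey h x hx).trans (hmono _ _ (le_add_of_nonneg_right (lyapunov_nonneg γ h')))
  · exact (hkey h' x hx).trans (hmono _ _ (le_add_of_nonneg_left (lyapunov_nonneg γ h)))

/-- The pointwise coupling estimate: an observable dominated by `1 + L` changes, between the next
states from `h` and from `h'` with the same innovation `z`, by at most a multiple of `b ^ γ`. -/
theorem abs_sub_step_le {γ : ℝ} (hγ : 0 < γ) {ψ : PosField → ℝ} {K : ℝ} (hK : 0 ≤ K)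
    (hψ : ∀ g, |ψ g| ≤ K * (1 + lyapunov γ g)) (b : Set.Ioo (0 : ℝ) 1) (θ : ℝ) (u : S2)
    (h h' z : PosField) {δ : ℝ} (hδ : 0 < δ) (hδb : δ ≤ 1 - b) (x₀ : S2) {H : ℝ} (hH : 0 < H)
    (hz : ∀ x y, (z x : ℝ) ≤ H * z y) :
    |ψ (step b θ u h z) - ψ (step b θ u h' z)| ≤
      K * (b : ℝ) ^ γ * (lyapunov γ h + lyapunov γ h') *
        (1 + 2 * (H / δ) ^ γ * (((z x₀ : ℝ) ^ γ)⁻¹ + H ^ γ)) := by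
  have hb := b.2.1.le
  have hw : (0 : ℝ) < z x₀ := (z x₀).2
  have hL := lyapunov_nonneg γ h
  have hL' := lyapunov_nonneg γ h'
  set S := (b : ℝ) ^ γ * (lyapunov γ h + lyapunov γ h') with hS
  have hS0 : 0 ≤ S := by positivity
  have hpos : 0 ≤ K * S * (1 + 2 * (H / δ) ^ γ * (((z x₀ : ℝ) ^ γ)⁻¹ + H ^ γ)) := by positivity
  rw [mul_assoc K, ← hS]
  by_cases heq : step b θ u h z = step b θ u h' z
  · rw [heq, sub_self, abs_zero]
    exact hpos
  have hone := one_le_of_step_ne (x₀ := x₀) hγ heq hδ hδb hH hz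
  have hN := lyapunov_le_of_le_mul (x₀ := x₀) hγ hH hz
  have h1 := lyapunov_step_le hγ b θ u h z
  have h2 := lyapunov_step_le hγ b θ u h' z
  have hwγ : 0 < (z x₀ : ℝ) ^ γ := Real.rpow_pos_of_pos hw γ
  rw [← hS] at hone
  have hN0 : 0 ≤ 1 + H ^ γ * (z x₀ : ℝ) ^ γ := by positivity
  calc |ψ (step b θ u h z) - ψ (step b θ u h' z)|
      ≤ K * (1 + lyapunov γ (step b θ u h z)) + K * (1 + lyapunov γ (step b θ u h' z)) :=
        (abs_sub _ _).trans (add_le_add (hψ _) (hψ _))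
    _ = K * ((1 + lyapunov γ (step b θ u h z)) + (1 + lyapunov γ (step b θ u h' z))) := by ring
    _ ≤ K * (S + 2 * (1 + H ^ γ * (z x₀ : ℝ) ^ γ) * 1) := by
        refine mul_le_mul_of_nonneg_left ?_ hK
        rw [hS]
        linarith
    _ ≤ K * (S + 2 * (1 + H ^ γ * (z x₀ : ℝ) ^ γ) *
          (S * ((H / δ) ^ γ * ((z x₀ : ℝ) ^ γ)⁻¹))) := by gcongr
    _ = K * S * (1 + 2 * (H / δ) ^ γ * (((z x₀ : ℝ) ^ γ)⁻¹ + H ^ γ)) := by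
        field_simp

/-! ### Integrated estimates -/

section

variable {κ : ℝ} {ν : Measure PosField} [IsProbabilityMeasure ν]

theorem IsMaxStableLaw.integrable_of_abs_le (hν : IsMaxStableLaw κ ν) {H : ℝ} (hH : 0 < H)
    (hHν : IsHarnack H ν) {γ : ℝ} (hγ : 0 < γ) (hγ1 : γ < 1) {ψ : PosField → ℝ}
    (hψm : Measurable ψ) {A K : ℝ} (hK : 0 ≤ K) (hψ : ∀ z, |ψ z| ≤ A + K * lyapunov γ z) :
    Integrable ψ ν := by
  obtain ⟨x₀⟩ : Nonempty S2 := inferInstance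
  refine Integrable.mono' ((integrable_const A).add
    (((hν.integrable_rpow x₀ hγ hγ1).const_mul (H ^ γ)).const_mul K))
    hψm.aestronglyMeasurable ?_
  filter_upwards [hHν] with z hz
  have := mul_le_mul_of_nonneg_left (lyapunov_le_of_le_mul (x₀ := x₀) hγ hH hz) hK
  exact (hψ z).trans (by simpa using this)

theorem IsMaxStableLaw.integrable_transitionKernel (hν : IsMaxStableLaw κ ν) {H : ℝ} (hH : 0 < H)
    (hHν : IsHarnack H ν) {γ : ℝ} (hγ : 0 < γ) (hγ1 : γ < 1) {ψ : PosField → ℝ}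
    (hψm : Measurable ψ) {K : ℝ} (hK : 0 ≤ K) (hψ : ∀ g, |ψ g| ≤ K * (1 + lyapunov γ g))
    (b : Set.Ioo (0 : ℝ) 1) (θ : ℝ) (u : S2) (h : PosField) :
    Integrable ψ (transitionKernel b θ u ν h) := by
  rw [transitionKernel_apply, integrable_map_measure hψm.aestronglyMeasurable
    (measurable_step_right b θ u h).aemeasurable]
  refine hν.integrable_of_abs_le (A := K * (1 + (b : ℝ) ^ γ * lyapunov γ h)) (K := K) hH hHν hγ hγ1
    (hψm.comp (measurable_step_right b θ u h)) hK fun z => (hψ _).trans ?_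
  rw [← mul_add]
  refine mul_le_mul_of_nonneg_left ?_ hK
  linarith [lyapunov_step_le hγ b θ u h z]

/-- Contraction of the kernel towards the stationary law, at the rate `b ^ γ`, uniformly over the
parameters `b` that stay away from one. -/
theorem IsMaxStableLaw.exists_contraction (hκ : 0 ≤ κ) (hν : IsMaxStableLaw κ ν) {H : ℝ}
    (hH : 0 < H) (hHν : IsHarnack H ν) {γ : ℝ} (hγ : 0 < γ) (hγ1 : γ < 1) {δ : ℝ} (hδ : 0 < δ) :
    ∃ C : ℝ, 1 ≤ C ∧ ∀ (b : Set.Ioo (0 : ℝ) 1) (θ : ℝ) (u : S2), δ ≤ 1 - b →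
      ∀ (φ : PosField → ℝ), Measurable φ → ∀ (K m : ℝ), 0 ≤ K →
        (∀ g, |φ g - m| ≤ K * (1 + lyapunov γ g)) → ∀ h : PosField,
          |∫ g, φ g ∂(transitionKernel b θ u ν h) - ∫ g, φ g ∂ν| ≤
            K * (C * (b : ℝ) ^ γ) * (1 + lyapunov γ h) := by
  obtain ⟨x₀⟩ : Nonempty S2 := inferInstance
  set N : PosField → ℝ := fun z => H ^ γ * (z x₀ : ℝ) ^ γ with hN
  set V : PosField → ℝ := fun z => 1 + 2 * (H / δ) ^ γ * (((z x₀ : ℝ) ^ γ)⁻¹ + H ^ γ) with hV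
  have hN0 : ∀ z, 0 ≤ N z := fun z =>
    mul_nonneg (Real.rpow_nonneg hH.le γ) (Real.rpow_nonneg (z x₀).2.le γ)
  have hV1 : ∀ z, 1 ≤ V z := fun z => by
    have : (0 : ℝ) < z x₀ := (z x₀).2
    refine le_add_of_nonneg_right ?_
    positivity
  have hNi : Integrable N ν := (hν.integrable_rpow x₀ hγ hγ1).const_mul _
  have hVi : Integrable V ν := (integrable_const 1).add
    (((hν.integrable_inv_rpow hκ x₀ hγ hγ1).add (integrable_const _)).const_mul _)
  have hNint : 0 ≤ ∫ z, N z ∂ν := integral_nonneg hN0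
  have hVint : 1 ≤ ∫ z, V z ∂ν := by
    have := integral_mono (integrable_const (μ := ν) (1 : ℝ)) hVi hV1
    simpa using this
  refine ⟨(1 + ∫ z, N z ∂ν) * ∫ z, V z ∂ν, by nlinarith, ?_⟩
  intro b θ u hδb φ hφm K m hK hφ h
  have hb : 0 ≤ (b : ℝ) := b.2.1.le
  have hL := lyapunov_nonneg γ h
  have hψm : Measurable fun g => φ g - m := hφm.sub_const m
  -- both integrals, written over the pair `(h', z)` of law `ν × ν`
  have hi1 : Integrable (fun z => φ (step b θ u h z)) ν := by
    have := (hν.integrable_transitionKernel hH hHν hγ hγ1 hψm hK hφ b θ u h).add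
      (integrable_const m)
    rw [transitionKernel_apply] at this
    have := this.comp_measurable (measurable_step_right b θ u h)
    simpa [Function.comp_def] using this
  have hi2 : Integrable φ ν := by
    have := (hν.integrable_of_abs_le (A := K) (K := K) hH hHν hγ hγ1 hψm hK
      fun z => (hφ z).trans_eq (by ring)).add (integrable_const m)
    exact this.congr (Filter.Eventually.of_forall fun z => sub_add_cancel _ _)
  have hi2' : Integrable (fun p : PosField × PosField => φ (step b θ u p.1 p.2)) (ν.prod ν) := by
    rw [← hν.map_step b θ u] at hi2
    exact hi2.comp_measurable (measurable_step b θ u)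
  have h1 : ∫ g, φ g ∂(transitionKernel b θ u ν h) =
      ∫ p, φ (step b θ u h p.2) ∂(ν.prod ν) := by
    rw [integral_fun_snd (fun z => φ (step b θ u h z)), transitionKernel_apply,
      integral_map (measurable_step_right b θ u h).aemeasurable hφm.aestronglyMeasurable]
    simp
  have h2 : ∫ g, φ g ∂ν = ∫ p, φ (step b θ u p.1 p.2) ∂(ν.prod ν) := by
    conv_lhs => rw [← hν.map_step b θ u]
    rw [integral_map (measurable_step b θ u).aemeasurable hφm.aestronglyMeasurable]
  rw [h1, h2, ← integral_sub (hi1.comp_snd ν) hi2', ← Real.norm_eq_abs]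
  have hbi : Integrable (fun p : PosField × PosField =>
      (K * (b : ℝ) ^ γ * (lyapunov γ h + N p.1)) * V p.2) (ν.prod ν) :=
    (((integrable_const _).add hNi).const_mul _).mul_prod hVi
  have hHarnack₁ : ∀ᵐ p ∂(ν.prod ν), ∀ x y : S2, (p.1 x : ℝ) ≤ H * p.1 y :=
    Measure.quasiMeasurePreserving_fst.ae hHν
  have hHarnack₂ : ∀ᵐ p ∂(ν.prod ν), ∀ x y : S2, (p.2 x : ℝ) ≤ H * p.2 y :=
    Measure.quasiMeasurePreserving_snd.ae hHν
  refine (norm_integral_le_of_norm_le hbi ?_).trans ?_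
  · filter_upwards [hHarnack₁, hHarnack₂] with p hp1 hp2
    have := abs_sub_step_le hγ hK hφ b θ u h p.1 p.2 hδ hδb x₀ hH hp2
    rw [sub_sub_sub_cancel_right] at this
    refine this.trans ?_
    have hV0 : 0 ≤ V p.2 := zero_le_one.trans (hV1 _)
    have hLN : lyapunov γ p.1 ≤ N p.1 := lyapunov_le_of_le_mul hγ hH hp1
    exact mul_le_mul_of_nonneg_right (by gcongr) hV0
  · rw [integral_prod_mul (fun g => K * (b : ℝ) ^ γ * (lyapunov γ h + N g)) V,
      integral_const_mul, integral_add (integrable_const _) hNi]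
    simp only [integral_const, probReal_univ, one_smul]
    have hbγ := Real.rpow_nonneg hb γ
    have : lyapunov γ h + ∫ z, N z ∂ν ≤ (1 + ∫ z, N z ∂ν) * (1 + lyapunov γ h) := by nlinarith
    calc K * (b : ℝ) ^ γ * (lyapunov γ h + ∫ z, N z ∂ν) * ∫ z, V z ∂ν
        ≤ K * (b : ℝ) ^ γ * ((1 + ∫ z, N z ∂ν) * (1 + lyapunov γ h)) * ∫ z, V z ∂ν := by gcongr
      _ = _ := by ring

end

/-! ### Geometric ergodicity -/

theorem abs_le_of_weightedNorm_lt_top {γ : ℝ} {φ : PosField → ℝ}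
    (hφ : weightedNorm (lyapunov γ) φ < ∞) (g : PosField) :
    |φ g| ≤ (weightedNorm (lyapunov γ) φ).toReal * (1 + lyapunov γ g) := by
  have hpos : 0 < 1 + lyapunov γ g := by linarith [lyapunov_nonneg γ g]
  rw [← div_le_iff₀ hpos, ← ENNReal.ofReal_le_iff_le_toReal hφ.ne]
  exact le_iSup (fun h => ENNReal.ofReal (|φ h| / (1 + lyapunov γ h))) g

theorem weightedNorm_le {γ : ℝ} {φ : PosField → ℝ} {K : ℝ}
    (hφ : ∀ g, |φ g| ≤ K * (1 + lyapunov γ g)) :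
    weightedNorm (lyapunov γ) φ ≤ ENNReal.ofReal K :=
  iSup_le fun g => ENNReal.ofReal_le_ofReal
    ((div_le_iff₀ (by linarith [lyapunov_nonneg γ g])).2 (hφ g))

theorem weightedNorm_sub_const_lt_top {γ : ℝ} {φ : PosField → ℝ}
    (hφ : weightedNorm (lyapunov γ) φ < ∞) (m : ℝ) :
    weightedNorm (lyapunov γ) (fun g => φ g - m) < ∞ := by
  refine (weightedNorm_le (K := (weightedNorm (lyapunov γ) φ).toReal + |m|)
    fun g => ?_).trans_lt ENNReal.ofReal_lt_top
  have h1 := abs_le_of_weightedNorm_lt_top hφ g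
  have h2 := mul_nonneg (abs_nonneg m) (lyapunov_nonneg γ g)
  have h3 := abs_sub (φ g) m
  linarith

section

variable {κ : ℝ} {ν : Measure PosField} [IsProbabilityMeasure ν]

theorem IsMaxStableLaw.integrable_transitionKernel_pow (hν : IsMaxStableLaw κ ν) {H : ℝ}
    (hH : 0 < H) (hHν : IsHarnack H ν) {γ : ℝ} (hγ : 0 < γ) (hγ1 : γ < 1) {φ : PosField → ℝ}
    (hφm : Measurable φ) {K : ℝ} (hK : 0 ≤ K) (hφ : ∀ g, |φ g| ≤ K * (1 + lyapunov γ g))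
    (a : Set.Ioo (0 : ℝ) 1) (θ : ℝ) (u : S2) (n : ℕ) (h : PosField) :
    Integrable φ ((transitionKernel a θ u ν ^ n) h) := by
  cases n with
  | zero =>
    rw [pow_zero, show ((1 : Kernel PosField PosField) h) = Measure.dirac h from Kernel.id_apply h]
    exact integrable_dirac (by simp)
  | succ n =>
    obtain ⟨b, θ', -, hP⟩ := hν.transitionKernel_pow a θ u n
    rw [hP]
    exact hν.integrable_transitionKernel hH hHν hγ hγ1 hφm hK hφ b θ' u h

/-- The contraction estimate for the `n`-step kernel. For `n ≥ 1` its parameter is `a ^ n ≤ a`, so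
that the constant for `1 - a` serves all `n`. -/
theorem IsMaxStableLaw.exists_geometric_bound (hκ : 0 ≤ κ) (hν : IsMaxStableLaw κ ν) {H : ℝ}
    (hH : 0 < H) (hHν : IsHarnack H ν) {γ : ℝ} (hγ : 0 < γ) (hγ1 : γ < 1)
    (a : Set.Ioo (0 : ℝ) 1) (θ : ℝ) (u : S2) :
    ∃ C : ℝ, 1 ≤ C ∧ ∀ (φ : PosField → ℝ), Measurable φ → ∀ K : ℝ, 0 ≤ K →
      (∀ g, |φ g - ∫ g, φ g ∂ν| ≤ K * (1 + lyapunov γ g)) → ∀ (n : ℕ) (h : PosField),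
        |∫ g, φ g ∂((transitionKernel a θ u ν ^ n) h) - ∫ g, φ g ∂ν| ≤
          K * (C * ((a : ℝ) ^ γ) ^ n) * (1 + lyapunov γ h) := by
  obtain ⟨C, hC, hbound⟩ := hν.exists_contraction hκ hH hHν hγ hγ1 (sub_pos.2 a.2.2)
  refine ⟨C, hC, fun φ hφm K hK hφ n h => ?_⟩
  cases n with
  | zero =>
    rw [pow_zero, pow_zero, mul_one,
      show ((1 : Kernel PosField PosField) h) = Measure.dirac h from Kernel.id_apply h,
      integral_dirac]
    have := lyapunov_nonneg γ h
    exact (hφ h).trans (by gcongr; exact le_mul_of_one_le_right hK hC)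
  | succ n =>
    obtain ⟨b, θ', hb, hP⟩ := hν.transitionKernel_pow a θ u n
    have hba : (b : ℝ) ≤ a := hb.trans_le (pow_le_of_le_one a.2.1.le a.2.2.le n.succ_ne_zero)
    have := hbound b θ' u (by linarith) φ hφm K _ hK hφ h
    rwa [hb, ← Real.rpow_natCast, ← Real.rpow_mul a.2.1.le, mul_comm ((n + 1 : ℕ) : ℝ) γ,
      Real.rpow_mul a.2.1.le, Real.rpow_natCast, ← hP] at this

theorem invariant_pow {P : Kernel PosField PosField} {μ : Measure PosField} (h : P.Invariant μ)
    (n : ℕ) : (P ^ n).Invariant μ := by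
  induction n with
  | zero => exact Measure.bind_dirac
  | succ n ih => exact ih.comp h

theorem IsMaxStableLaw.eq_of_invariant (hκ : 0 ≤ κ) (hν : IsMaxStableLaw κ ν) {H : ℝ}
    (hH : 0 < H) (hHν : IsHarnack H ν) (a : Set.Ioo (0 : ℝ) 1) (θ : ℝ) (u : S2)
    {μ : Measure PosField} [IsProbabilityMeasure μ]
    (hμ : (transitionKernel a θ u ν).Invariant μ) : μ = ν := by
  have hpow : ∀ n, IsMarkovKernel (transitionKernel a θ u ν ^ n) := fun n => by
    induction n with
    | zero => exact inferInstanceAs (IsMarkovKernel Kernel.id)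
    | succ n ih => exact inferInstanceAs (IsMarkovKernel
        ((transitionKernel a θ u ν ^ n) ∘ₖ transitionKernel a θ u ν))
  obtain ⟨C, hC, hbound⟩ := hν.exists_geometric_bound hκ hH hHν (γ := 1 / 2) (by norm_num)
    (by norm_num) a θ u
  ext s hs
  have hφm : Measurable (s.indicator fun _ => (1 : ℝ)) := measurable_const.indicator hs
  have hind : ∀ μ' : Measure PosField,
      ∫ g, s.indicator (fun _ => (1 : ℝ)) g ∂μ' = μ'.real s := fun _ => integral_indicator_one hs
  -- the transition probabilities of `s` converge to `ν s` from every starting point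
  have hlim : ∀ h, Filter.Tendsto (fun n => (transitionKernel a θ u ν ^ n) h s) Filter.atTop
      (nhds (ν s)) := by
    intro h
    have hreal : Filter.Tendsto (fun n => ((transitionKernel a θ u ν ^ n) h).real s) Filter.atTop
        (nhds (ν.real s)) := by
      have hρ : Filter.Tendsto (fun n : ℕ => 1 * (C * ((a : ℝ) ^ (1 / 2 : ℝ)) ^ n) *
          (1 + lyapunov (1 / 2) h)) Filter.atTop (nhds 0) := by
        have := tendsto_pow_atTop_nhds_zero_of_lt_one (Real.rpow_nonneg a.2.1.le (1 / 2 : ℝ))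
          (Real.rpow_lt_one a.2.1.le a.2.2 (by norm_num))
        simpa using ((this.const_mul C).const_mul 1).mul_const (1 + lyapunov (1 / 2) h)
      refine tendsto_iff_dist_tendsto_zero.2
        (squeeze_zero (fun _ => dist_nonneg) (fun n => ?_) hρ)
      have := hbound _ hφm 1 zero_le_one (fun g => ?_) n h
      · rwa [hind, hind, ← Real.dist_eq] at this
      · have hL := lyapunov_nonneg (1 / 2) g
        have h0 : 0 ≤ ν.real s := measureReal_nonneg
        have h1 : ν.real s ≤ 1 := measureReal_le_one
        rw [hind, one_mul, abs_le]
        by_cases hg : g ∈ s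
        · rw [Set.indicator_of_mem hg]
          constructor <;> linarith
        · rw [Set.indicator_of_notMem hg]
          constructor <;> linarith
    have := (ENNReal.continuous_ofReal.tendsto _).comp hreal
    simpa [Function.comp_def] using this
  have hconst : ∀ n, ∫⁻ h, (transitionKernel a θ u ν ^ n) h s ∂μ = μ s := fun n => by
    rw [← Measure.bind_apply hs (Kernel.aemeasurable _), (invariant_pow hμ n).def]
  have hlint := tendsto_lintegral_of_dominated_convergence (μ := μ) (fun _ => (1 : ℝ≥0∞))
    (fun n => Kernel.measurable_coe _ hs)
    (fun n => Filter.Eventually.of_forall fun h => prob_le_one) (by simp)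
    (Filter.Eventually.of_forall hlim)
  simp only [hconst, lintegral_const, measure_univ, mul_one] at hlint
  exact tendsto_nhds_unique tendsto_const_nhds hlint

end

theorem theorem4 (a : Set.Ioo (0 : ℝ) 1) (θ : ℝ) (u : S2) (κ : ℝ) (hκ : 0 ≤ κ)
    {Ω' : Type*} [MeasurableSpace Ω'] (Pr' : Measure Ω') [IsProbabilityMeasure Pr']
    (U : ℕ → Ω' → Set.Ioi (0 : ℝ)) (M : ℕ → Ω' → S2)
    (hUM : IsPoissonPointProcess (fun i ω => (U i ω, M i ω)) (invSqMeasure.prod sphereMeasure) Pr')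
    {Ω : Type*} [MeasurableSpace Ω] (Pr : Measure Ω) [IsProbabilityMeasure Pr]
    (X Z : ℤ → Ω → PosField) (hXZ : IsMaxAutoregressive a θ u X Z Pr)
    (hZ : ∀ t : ℤ, EqInDistribution κ (Z t) Pr U M Pr')
    (P : Kernel PosField PosField) (hP : P = transitionKernel a θ u (Pr.map (Z 0))) :
    IsMarkovChain X P Pr ∧
    ∃ π : Measure PosField,
      (IsProbabilityMeasure π ∧ P.Invariant π ∧
        ∀ π' : Measure PosField, IsProbabilityMeasure π' → P.Invariant π' → π' = π) ∧
      ∀ γ : ℝ, 0 < γ → γ < 1 →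
        ∃ C ρ : ℝ, 0 < C ∧ 0 < ρ ∧ ρ < 1 ∧
          ∀ φ : PosField → ℝ, Measurable φ → weightedNorm (lyapunov γ) φ < ∞ →
            Integrable φ π ∧
            ∀ n : ℕ,
              (∀ h : PosField, Integrable φ ((P ^ n) h)) ∧
              weightedNorm (lyapunov γ) (fun h => (∫ g, φ g ∂((P ^ n) h)) - ∫ g, φ g ∂π) ≤
                ENNReal.ofReal (C * ρ ^ n) *
                  weightedNorm (lyapunov γ) (fun h => φ h - ∫ g, φ g ∂π) := by
  have hprob : ∀ t, IsProbabilityMeasure (Pr.map (Z t)) := fun t =>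
    Measure.isProbabilityMeasure_map (hXZ.measurable_innovation t).aemeasurable
  have hlaw : ∀ t, IsMaxStableLaw κ (Pr.map (Z t)) := fun t =>
    (hZ t).isMaxStableLaw hκ hUM (hXZ.measurable_innovation t)
  have hchain := hXZ.isMarkovChain fun t => (hlaw t).eq (hlaw 0)
  have hH : 0 < Real.exp (2 * κ) := Real.exp_pos _
  have hν := hlaw 0
  have hHν : IsHarnack (Real.exp (2 * κ)) (Pr.map (Z 0)) :=
    (hZ 0).isHarnack hκ (hXZ.measurable_innovation 0)
  subst hP
  have := hprob 0
  set ν := Pr.map (Z 0)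
  refine ⟨hchain, ν, ⟨inferInstance, hν.invariant a θ u, fun μ _ hμ =>
    hν.eq_of_invariant hκ hH hHν a θ u hμ⟩, fun γ hγ hγ1 => ?_⟩
  obtain ⟨C, hC, hbound⟩ := hν.exists_geometric_bound hκ hH hHν hγ hγ1 a θ u
  refine ⟨C, (a : ℝ) ^ γ, by linarith, Real.rpow_pos_of_pos a.2.1 γ,
    Real.rpow_lt_one a.2.1.le a.2.2 hγ, fun φ hφm hφ => ⟨?_, fun n => ⟨fun h => ?_, ?_⟩⟩⟩
  · exact hν.integrable_of_abs_le hH hHν hγ hγ1 hφm ENNReal.toReal_nonneg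
      fun z => (abs_le_of_weightedNorm_lt_top hφ z).trans_eq (by ring)
  · exact hν.integrable_transitionKernel_pow hH hHν hγ hγ1 hφm ENNReal.toReal_nonneg
      (abs_le_of_weightedNorm_lt_top hφ) a θ u n h
  · have hψ := weightedNorm_sub_const_lt_top hφ (∫ g, φ g ∂ν)
    refine (weightedNorm_le (hbound φ hφm _ ENNReal.toReal_nonneg
      (abs_le_of_weightedNorm_lt_top hψ) n)).trans_eq ?_
    rw [ENNReal.ofReal_mul ENNReal.toReal_nonneg, ENNReal.ofReal_toReal hψ.ne, mul_comm]
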